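/- Let $V:(\mathbb{R}/\mathbb{Z})^2\to\mathbb{R}$ be a bounded measurable function that is (piecewise) Hölder continuous in the second variable, uniformly in the first: there are $\gamma>0$, $K<\infty$ and points $0=a_1<a_2<\cdots<a_m=1$ such that $$|V(x,y_1)-V(x,y_2)|\le K|y_1-y_2|^{\gamma}\qquad\text{for all }x\in\mathbb{R}/\mathbb{Z},\ 1\le i\le m-1,\ y_1,y_2\in[a_i,a_{i+1}].$$ Let $\omega\in\mathbb{R}$ and let $H$ be the Schrödinger operator $$(Hu)(x)=-u''(x)+V(x,\omega x)\,u(x)$$ on $L^2(\mathbb{R})$, with domain the set of $u\in L^2(\mathbb{R})$ such that $u$ is differentiable, $u'$ is locally absolutely continuous and $Hu\in L^2(\mathbb{R})$. Suppose that $$\beta(\omega)=\limsup_{k\to\infty}\frac{-\ln\|k\omega\|}{k}=\infty,$$ where $\|t\|=\operatorname{dist}(t,\mathbb{Z})$ and $-\ln 0=+\infty$. Then $H$ has no eigenvalues: there is no $E\in\mathbb{C}$ for which $Hu=Eu$ for some nonzero $u$ in the domain of $H$. -/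

import Mathlib

open MeasureTheory Filter

/-- `V : (ℝ/ℤ)² → ℝ` is piecewise `γ`-Hölder continuous with respect to the second variable:
it is (Lebesgue) measurable and bounded, and there are points `0 = a₀ < a₁ < ⋯ < aₙ = 1` such that
`V (x, ·)` is `γ`-Hölder on each closed interval `[aᵢ, aᵢ₊₁]`, with a constant uniform in `x`. -/
structure IsPiecewiseHolderSnd (γ : ℝ) (V : UnitAddCircle × UnitAddCircle → ℝ) : Prop where
  aemeasurable : AEMeasurable V (volume.prod volume)
  bounded : ∃ M : ℝ, ∀ p, |V p| ≤ M
  holder : ∃ (n : ℕ) (a : Fin (n + 1) → ℝ), StrictMono a ∧ a 0 = 0 ∧ a (Fin.last n) = 1 ∧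
    ∃ K : ℝ, ∀ (x : UnitAddCircle) (i : Fin n),
      ∀ y₁ ∈ Set.Icc (a i.castSucc) (a i.succ), ∀ y₂ ∈ Set.Icc (a i.castSucc) (a i.succ),
        |V (x, (y₁ : UnitAddCircle)) - V (x, (y₂ : UnitAddCircle))| ≤ K * |y₁ - y₂| ^ γ

/-- `β(ω) = limsup_{k → ∞} (-ln ‖kω‖) / k`, an extended real number, where `‖·‖`, the norm of
`ℝ/ℤ`, is the distance to the nearest integer and `-ln 0 = +∞`. -/
noncomputable def betaExponent (ω : ℝ) : EReal :=
  limsup (fun k : ℕ =>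
    -ENNReal.log (ENNReal.ofReal ‖((k * ω : ℝ) : UnitAddCircle)‖) / (k : EReal)) atTop

/-- The differential expression `(Hu)(x) = -u''(x) + V(x, ωx) u(x)`. -/
noncomputable def schrodinger (V : UnitAddCircle × UnitAddCircle → ℝ) (ω : ℝ) (u : ℝ → ℂ) :
    ℝ → ℂ :=
  fun x => -deriv (deriv u) x + (V ((x : UnitAddCircle), ((ω * x : ℝ) : UnitAddCircle)) : ℂ) * u x

/-- The (maximal) domain of `H` in `L²(ℝ)`: functions `u ∈ L²(ℝ)` which are differentiable with
locally absolutely continuous derivative and satisfy `Hu ∈ L²(ℝ)`. For bounded measurable `V` this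
is the Sobolev space `H²(ℝ)`, each class being given by its differentiable representative. -/
structure MemSchrodingerDomain (V : UnitAddCircle × UnitAddCircle → ℝ) (ω : ℝ) (u : ℝ → ℂ) :
    Prop where
  differentiable : Differentiable ℝ u
  deriv_absolutelyContinuous : ∀ s t : ℝ, AbsolutelyContinuousOnInterval (deriv u) s t
  memLp : MemLp u 2 volume
  memLp_schrodinger : MemLp (schrodinger V ω u) 2 volume

/-- `E` is an eigenvalue of `H` on `L²(ℝ)`: `Hu = Eu` for some `u ≠ 0` in the domain of `H`
(equalities in `L²(ℝ)`). -/
def IsSchrodingerEigenvalue (V : UnitAddCircle × UnitAddCircle → ℝ) (ω : ℝ) (E : ℂ) : Prop :=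
  ∃ u : ℝ → ℂ, MemSchrodingerDomain V ω u ∧ ¬ (u =ᵐ[volume] 0) ∧
    schrodinger V ω u =ᵐ[volume] fun x => E * u x

/-! A Gordon-type argument in which a Wronskian replaces transfer matrices. With q(x) = V(x, ωx) -
E, an eigenfunction solves u'' = qu. Translation by an integer k fixes the first variable of V and
moves the second by kω, so Hölder continuity gives |q(x+k) - q(x)| ≤ K‖kω‖^γ. As β(ω) = ∞, for every
L this is at most δ = K e^{-Lk} for infinitely many k.

Since q is bounded and u ∈ L², both u and u' vanish at infinity (`tendsto_zero`). Hence the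
Wronskian of u and u(·+k) vanishes at +∞; its derivative is (q(·+k) - q) u u(·+k), so it is at most
δ‖u‖₂² everywhere (`norm_wronskian_le`). If u(x₀) ≠ 0, the Cauchy data of u(·+k) at x₀ are therefore
nearly c times those of u, where c = u(x₀+k)/u(x₀). Solving backward over length k
(`norm_sub_const_mul_le`) costs a factor e^{(C+1)k}, C bounding |q|, which δ beats once L = C+2. So
u(x₀) ≈ c u(x₀-k), although c and u(x₀-k) are both small: a contradiction
(`eq_zero_of_almost_periods`). Neither self-adjointness nor reality of E plays a role. -/

namespace AbsolutelyContinuousOnInterval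

/-! ### Complex-valued absolutely continuous functions -/

lemma lipschitzWith_comp {X Y : Type*} [PseudoMetricSpace X] [PseudoMetricSpace Y] {f : ℝ → X}
    {φ : X → Y} {a b : ℝ} (hf : AbsolutelyContinuousOnInterval f a b) (hφ : LipschitzWith 1 φ) :
    AbsolutelyContinuousOnInterval (fun x => φ (f x)) a b := by
  rw [absolutelyContinuousOnInterval_iff] at hf ⊢
  intro ε hε
  obtain ⟨δ, hδ, h⟩ := hf ε hε
  refine ⟨δ, hδ, fun I hI hlen => lt_of_le_of_lt ?_ (h I hI hlen)⟩
  exact Finset.sum_le_sum fun i _ => by simpa using hφ.dist_le_mul _ _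

lemma comp_add_right {X : Type*} [PseudoMetricSpace X] {f : ℝ → X} {a b c : ℝ}
    (hf : AbsolutelyContinuousOnInterval f (a + c) (b + c)) :
    AbsolutelyContinuousOnInterval (fun x => f (x + c)) a b := by
  rw [absolutelyContinuousOnInterval_iff] at hf ⊢
  intro ε hε
  obtain ⟨δ, hδ, h⟩ := hf ε hε
  refine ⟨δ, hδ, fun E hE hlen => ?_⟩
  have key := h (E.1, fun i => ((E.2 i).1 + c, (E.2 i).2 + c)) ?_ (by simpa using hlen)
  · simpa using key
  · refine ⟨fun i hi => ?_, fun i hi j hj hij => ?_⟩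
    · have := hE.1 i hi
      rw [← Set.image_add_const_uIcc]
      exact ⟨⟨_, this.1, rfl⟩, ⟨_, this.2, rfl⟩⟩
    · have := hE.2 hi hj hij
      simp only [Function.onFun, Set.disjoint_left] at this ⊢
      intro x hx hx'
      refine this (a := x - c) ?_ ?_
      · rw [Set.mem_uIoc] at hx ⊢
        rcases hx with h | h
        · left; constructor <;> linarith [h.1, h.2]
        · right; constructor <;> linarith [h.1, h.2]
      · rw [Set.mem_uIoc] at hx' ⊢
        rcases hx' with h | h
        · left; constructor <;> linarith [h.1, h.2]
        · right; constructor <;> linarith [h.1, h.2]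

/-- Fundamental theorem of calculus for complex-valued absolutely continuous functions. -/
theorem intervalIntegrable_and_integral_eq_sub {f g : ℝ → ℂ} {a b : ℝ}
    (hf : AbsolutelyContinuousOnInterval f a b)
    (hg : ∀ᵐ x, x ∈ Set.uIcc a b → HasDerivAt f (g x) x) :
    IntervalIntegrable g volume a b ∧ ∫ x in a..b, g x = f b - f a := by
  have hre := hf.lipschitzWith_comp (φ := Complex.re)
    (LipschitzWith.of_dist_le_mul fun x y => by
      simpa [Complex.dist_eq, Real.dist_eq] using Complex.abs_re_le_norm (x - y))
  have him := hf.lipschitzWith_comp (φ := Complex.im)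
    (LipschitzWith.of_dist_le_mul fun x y => by
      simpa [Complex.dist_eq, Real.dist_eq] using Complex.abs_im_le_norm (x - y))
  have dre : ∀ᵐ x, x ∈ Set.uIoc a b → deriv (fun x => (f x).re) x = (g x).re := by
    filter_upwards [hg] with x hx hxm
    exact (Complex.reCLM.hasFDerivAt.comp_hasDerivAt x (hx (Set.uIoc_subset_uIcc hxm))).deriv
  have dim : ∀ᵐ x, x ∈ Set.uIoc a b → deriv (fun x => (f x).im) x = (g x).im := by
    filter_upwards [hg] with x hx hxm
    exact (Complex.imCLM.hasFDerivAt.comp_hasDerivAt x (hx (Set.uIoc_subset_uIcc hxm))).deriv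
  have ire : IntervalIntegrable (fun x => (g x).re) volume a b :=
    hre.intervalIntegrable_deriv.congr_ae (by
      rwa [EventuallyEq, ae_restrict_iff' measurableSet_uIoc])
  have iim : IntervalIntegrable (fun x => (g x).im) volume a b :=
    him.intervalIntegrable_deriv.congr_ae (by
      rwa [EventuallyEq, ae_restrict_iff' measurableSet_uIoc])
  have ig : IntervalIntegrable g volume a b := by
    have h1 : IntervalIntegrable (fun x => ((g x).re : ℂ)) volume a b :=
      ⟨ire.1.ofReal, ire.2.ofReal⟩
    have h2 : IntervalIntegrable (fun x => ((g x).im : ℂ)) volume a b :=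
      ⟨iim.1.ofReal, iim.2.ofReal⟩
    have := h1.add (h2.mul_const Complex.I)
    simpa only [Complex.re_add_im] using this
  refine ⟨ig, ?_⟩
  have e1 : ∫ x in a..b, (g x).re = (f b).re - (f a).re := by
    rw [← hre.integral_deriv_eq_sub]
    exact intervalIntegral.integral_congr_ae (by filter_upwards [dre] with x hx h using (hx h).symm)
  have e2 : ∫ x in a..b, (g x).im = (f b).im - (f a).im := by
    rw [← him.integral_deriv_eq_sub]
    exact intervalIntegral.integral_congr_ae (by filter_upwards [dim] with x hx h using (hx h).symm)
  apply Complex.ext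
  · have := Complex.reCLM.intervalIntegral_comp_comm ig
    simp only [Complex.reCLM_apply] at this
    rw [← this, e1, Complex.sub_re]
  · have := Complex.imCLM.intervalIntegral_comp_comm ig
    simp only [Complex.imCLM_apply] at this
    rw [← this, e2, Complex.sub_im]

theorem ae_differentiableAt_complex {f : ℝ → ℂ} {a b : ℝ}
    (hf : AbsolutelyContinuousOnInterval f a b) :
    ∀ᵐ x, x ∈ Set.uIcc a b → DifferentiableAt ℝ f x := by
  have hre := hf.lipschitzWith_comp (φ := Complex.re)
    (LipschitzWith.of_dist_le_mul fun x y => by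
      simpa [Complex.dist_eq, Real.dist_eq] using Complex.abs_re_le_norm (x - y))
  have him := hf.lipschitzWith_comp (φ := Complex.im)
    (LipschitzWith.of_dist_le_mul fun x y => by
      simpa [Complex.dist_eq, Real.dist_eq] using Complex.abs_im_le_norm (x - y))
  filter_upwards [hre.ae_differentiableAt, him.ae_differentiableAt] with x h1 h2 hx
  have e1 := (h1 hx).hasDerivAt.ofReal_comp
  have e2 := (h2 hx).hasDerivAt.ofReal_comp
  have := e1.add (e2.mul_const Complex.I)
  refine (this.congr_of_eventuallyEq (Eventually.of_forall fun y => ?_)).differentiableAt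
  simp [Complex.re_add_im]

end AbsolutelyContinuousOnInterval

/-! ### Grönwall's inequality and estimates for u'' = qu -/

/-- `f x ≤ a + C ∫₀ˣ f` on `[0, T]` implies `f T ≤ a exp (C T)`. -/
theorem le_mul_exp_of_le_add_integral {f : ℝ → ℝ} (hf : Continuous f) {a C T : ℝ} (hC : 0 ≤ C)
    (hT : 0 ≤ T) (h : ∀ x ∈ Set.Icc 0 T, f x ≤ a + C * ∫ s in (0 : ℝ)..x, f s) :
    f T ≤ a * Real.exp (C * T) := by
  have hd : ∀ x, HasDerivAt (fun x => a + C * ∫ s in (0 : ℝ)..x, f s) (C * f x) x := fun x =>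
    ((hf.integral_hasStrictDerivAt 0 x).hasDerivAt.const_mul C).const_add a
  -- Grönwall is applied to the majorant, which is differentiable although f need not be.
  have key := le_gronwallBound_of_liminf_deriv_right_le (δ := a) (K := C) (ε := 0) (a := 0) (b := T)
    (f := fun x => a + C * ∫ s in (0 : ℝ)..x, f s) (f' := fun x => C * f x)
    (fun x _ => (hd x).continuousAt.continuousWithinAt)
    (fun x _ r hr => (hd x).hasDerivWithinAt.liminf_right_slope_le hr) (by simp)
    (fun x hx => by
      have := mul_le_mul_of_nonneg_left (h x ⟨hx.1, hx.2.le⟩) hC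
      simpa using this) T ⟨hT, le_rfl⟩
  rw [gronwallBound_ε0, sub_zero] at key
  exact (h T ⟨hT, le_rfl⟩).trans key

/-- `u` is a Carathéodory solution of `u'' = q u` on the line. -/
structure IsCaratheodorySolution (q u : ℝ → ℂ) : Prop where
  differentiable : Differentiable ℝ u
  absolutelyContinuous : ∀ s t : ℝ, AbsolutelyContinuousOnInterval (deriv u) s t
  ae_hasDerivAt : ∀ᵐ x, HasDerivAt (deriv u) (q x * u x) x

namespace IsCaratheodorySolution

variable {q q₁ u u₁ : ℝ → ℂ} {C : ℝ}

lemma continuous (h : IsCaratheodorySolution q u) : Continuous u := h.differentiable.continuous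

lemma continuous_deriv (h : IsCaratheodorySolution q u) : Continuous (deriv u) := by
  rw [continuous_iff_continuousAt]
  intro x
  have := (h.absolutelyContinuous (x - 1) (x + 1)).continuousOn
  rw [Set.uIcc_of_le (by linarith)] at this
  exact this.continuousAt (Icc_mem_nhds (by linarith) (by linarith))

lemma absolutelyContinuous_self (h : IsCaratheodorySolution q u) (a b : ℝ) :
    AbsolutelyContinuousOnInterval u a b :=
  (contDiff_one_iff_deriv.2 ⟨h.differentiable, h.continuous_deriv⟩).contDiffOn
    |>.absolutelyContinuousOnInterval

lemma comp_add_right (h : IsCaratheodorySolution q u) (c : ℝ) :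
    IsCaratheodorySolution (fun x => q (x + c)) (fun x => u (x + c)) := by
  have hd : deriv (fun x => u (x + c)) = fun x => deriv u (x + c) :=
    funext fun x => deriv_comp_add_const u c x
  refine ⟨h.differentiable.comp (differentiable_id.add_const c), fun s t => ?_, ?_⟩
  · rw [hd]
    exact (h.absolutelyContinuous _ _).comp_add_right
  · rw [hd]
    have := (measurePreserving_add_right volume c).quasiMeasurePreserving.ae h.ae_hasDerivAt
    filter_upwards [this] with x hx
    exact hx.comp_add_const x c

lemma intervalIntegrable (h : IsCaratheodorySolution q u) (a b : ℝ) :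
    IntervalIntegrable (fun x => q x * u x) volume a b :=
  ((h.absolutelyContinuous a b).intervalIntegrable_and_integral_eq_sub
    (h.ae_hasDerivAt.mono fun _ hx _ => hx)).1

lemma integral_eq_sub (h : IsCaratheodorySolution q u) (a b : ℝ) :
    ∫ x in a..b, q x * u x = deriv u b - deriv u a :=
  ((h.absolutelyContinuous a b).intervalIntegrable_and_integral_eq_sub
    (h.ae_hasDerivAt.mono fun _ hx _ => hx)).2

lemma norm_deriv_sub_le (h : IsCaratheodorySolution q u) (hq : ∀ x, ‖q x‖ ≤ C) {a b : ℝ}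
    (hab : a ≤ b) : ‖deriv u b - deriv u a‖ ≤ C * ∫ x in a..b, ‖u x‖ := by
  rw [← h.integral_eq_sub, ← intervalIntegral.integral_const_mul]
  refine intervalIntegral.norm_integral_le_of_norm_le hab (Eventually.of_forall fun x _ => ?_)
    ((continuous_const.mul h.continuous.norm).intervalIntegrable _ _)
  rw [norm_mul]
  exact mul_le_mul_of_nonneg_right (hq x) (norm_nonneg _)

/-- The increment of the Wronskian of two solutions. -/
lemma wronskian_sub_eq (h : IsCaratheodorySolution q u) (h₁ : IsCaratheodorySolution q₁ u₁)
    (a b : ℝ) :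
    (u b * deriv u₁ b - deriv u b * u₁ b) - (u a * deriv u₁ a - deriv u a * u₁ a) =
      ∫ x in a..b, (q₁ x - q x) * (u x * u₁ x) := by
  have hac : AbsolutelyContinuousOnInterval (fun x => u x * deriv u₁ x - deriv u x * u₁ x) a b :=
    ((h.absolutelyContinuous_self a b).smul (h₁.absolutelyContinuous a b)).sub
      ((h.absolutelyContinuous a b).smul (h₁.absolutelyContinuous_self a b))
  refine (hac.intervalIntegrable_and_integral_eq_sub ?_).2.symm
  filter_upwards [h.ae_hasDerivAt, h₁.ae_hasDerivAt] with x hx hx₁ _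
  refine (((h.differentiable x).hasDerivAt.mul hx₁).sub
    (hx.mul (h₁.differentiable x).hasDerivAt)).congr_deriv ?_
  ring

lemma norm_wronskian_sub_le (h : IsCaratheodorySolution q u) (h₁ : IsCaratheodorySolution q₁ u₁)
    {δ : ℝ} (hδ : ∀ x, ‖q₁ x - q x‖ ≤ δ) {a b : ℝ} (hab : a ≤ b) :
    ‖(u b * deriv u₁ b - deriv u b * u₁ b) - (u a * deriv u₁ a - deriv u a * u₁ a)‖ ≤
      δ * ∫ x in a..b, ‖u x‖ * ‖u₁ x‖ := by
  rw [h.wronskian_sub_eq h₁, ← intervalIntegral.integral_const_mul]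
  refine intervalIntegral.norm_integral_le_of_norm_le hab (Eventually.of_forall fun x _ => ?_)
    ((continuous_const.mul (h.continuous.norm.mul h₁.continuous.norm)).intervalIntegrable _ _)
  rw [norm_mul, norm_mul]
  exact mul_le_mul_of_nonneg_right (hδ x) (by positivity)

/-- A solution and its derivative at a point are controlled by the local `L¹` norm. -/
lemma norm_add_norm_deriv_le (h : IsCaratheodorySolution q u) (hq : ∀ x, ‖q x‖ ≤ C) (x : ℝ) :
    ‖u x‖ + ‖deriv u x‖ ≤ 19 * (1 + C) * ∫ y in x..(x + 1), ‖u y‖ := by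
  have hC : 0 ≤ C := (norm_nonneg _).trans (hq 0)
  set A := ∫ y in x..(x + 1), ‖u y‖ with hA
  have hmono : ∀ y ∈ Set.Icc x (x + 1), ∫ t in x..y, ‖u t‖ ≤ A := fun y hy =>
    intervalIntegral.integral_mono_interval le_rfl hy.1 hy.2
      (Eventually.of_forall fun t => norm_nonneg (u t)) (h.continuous.norm.intervalIntegrable _ _)
  have hA0 : 0 ≤ A := intervalIntegral.integral_nonneg (by linarith) fun _ _ => norm_nonneg _
  -- First-order Taylor remainder: the equation bounds the variation of u' on the unit interval by
  -- C·A.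
  have hrem : ∀ y ∈ Set.Icc x (x + 1), ‖u y - (u x + ((y - x : ℝ) : ℂ) * deriv u x)‖ ≤ C * A := by
    intro y hy
    have := norm_image_sub_le_of_norm_deriv_le_segment' (a := x) (b := x + 1)
      (f := fun y => u y - ((y - x : ℝ) : ℂ) * deriv u x)
      (f' := fun y => deriv u y - deriv u x) (C := C * A) (fun z _ => ?_) (fun z hz => ?_) y hy
    · refine le_trans (le_of_eq ?_) (this.trans ?_)
      · congr 1; simp; ring
      · exact mul_le_of_le_one_right (by positivity) (by linarith [hy.2])
    · have e := ((h.differentiable z).hasDerivAt.sub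
        ((((hasDerivAt_id z).sub_const x).ofReal_comp).mul_const (deriv u x)))
      exact (e.congr_deriv (by simp)).hasDerivWithinAt
    · exact (h.norm_deriv_sub_le hq hz.1).trans
        (mul_le_mul_of_nonneg_left (hmono z ⟨hz.1, hz.2.le⟩) hC)
  have key : ∀ c : ℝ, 0 ≤ c → c ≤ 1 →
      ‖(c : ℂ) * u x + (c : ℂ) ^ 2 / 2 * deriv u x‖ ≤ (1 + C) * A := by
    intro c hc hc1
    have hi : ∫ y in x..(x + c), (u x + ((y - x : ℝ) : ℂ) * deriv u x)
        = (c : ℂ) * u x + (c : ℂ) ^ 2 / 2 * deriv u x := by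
      have := intervalIntegral.integral_eq_sub_of_hasDerivAt (a := x) (b := x + c)
        (f := fun y : ℝ => ((y - x : ℝ) : ℂ) * u x + ((y - x : ℝ) : ℂ) ^ 2 / 2 * deriv u x)
        (f' := fun y => u x + ((y - x : ℝ) : ℂ) * deriv u x) (fun y _ => ?_)
        (Continuous.intervalIntegrable (by fun_prop) _ _)
      · rw [this]; simp
      · have e := ((hasDerivAt_id y).sub_const x).ofReal_comp
        exact ((e.mul_const (u x)).add (((e.pow 2).div_const 2).mul_const (deriv u x))).congr_deriv
          (by simp)
    have hs : ∫ y in x..(x + c), (u x + ((y - x : ℝ) : ℂ) * deriv u x) =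
        (∫ y in x..(x + c), u y) -
          ∫ y in x..(x + c), (u y - (u x + ((y - x : ℝ) : ℂ) * deriv u x)) := by
      rw [← intervalIntegral.integral_sub (h.continuous.intervalIntegrable _ _)
        (Continuous.intervalIntegrable (by have := h.continuous; fun_prop) _ _)]
      simp
    rw [← hi, hs]
    refine (norm_sub_le _ _).trans ?_
    have b1 : ‖∫ y in x..(x + c), u y‖ ≤ A :=
      (intervalIntegral.norm_integral_le_integral_norm (by linarith)).trans
        (hmono _ ⟨by linarith, by linarith⟩)
    have b2 : ‖∫ y in x..(x + c), (u y - (u x + ((y - x : ℝ) : ℂ) * deriv u x))‖ ≤ C * A := by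
      refine (intervalIntegral.norm_integral_le_of_norm_le_const (C := C * A) fun y hy => ?_).trans ?_
      · rw [Set.uIoc_of_le (by linarith)] at hy
        exact hrem y ⟨hy.1.le, by linarith [hy.2]⟩
      · rw [add_sub_cancel_left, abs_of_nonneg hc]
        exact mul_le_of_le_one_right (by positivity) hc1
    linarith
  -- The averages over lengths 1 and 1/2 form an invertible linear system for u(x), u'(x). Solving
  -- it gives the constants 12 = 4 + 8 and 7 = 1 + 12/2, whose sum is 19.
  have k1 := key 1 (by norm_num) le_rfl
  have k2 := key (1 / 2) (by norm_num) (by norm_num)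
  have hd : ‖deriv u x‖ ≤ 12 * ((1 + C) * A) := by
    have e : deriv u x = 4 * (((1 : ℝ) : ℂ) * u x + ((1 : ℝ) : ℂ) ^ 2 / 2 * deriv u x) -
        8 * (((1 / 2 : ℝ) : ℂ) * u x + ((1 / 2 : ℝ) : ℂ) ^ 2 / 2 * deriv u x) := by
      push_cast; ring
    have := norm_sub_le (4 * (((1 : ℝ) : ℂ) * u x + ((1 : ℝ) : ℂ) ^ 2 / 2 * deriv u x))
      (8 * (((1 / 2 : ℝ) : ℂ) * u x + ((1 / 2 : ℝ) : ℂ) ^ 2 / 2 * deriv u x))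
    rw [← e, norm_mul, norm_mul, RCLike.norm_ofNat, RCLike.norm_ofNat] at this
    linarith
  have hu : ‖u x‖ ≤ 7 * ((1 + C) * A) := by
    have e : u x = (((1 : ℝ) : ℂ) * u x + ((1 : ℝ) : ℂ) ^ 2 / 2 * deriv u x) -
        (1 / 2) * deriv u x := by
      push_cast; ring
    have := norm_sub_le (((1 : ℝ) : ℂ) * u x + ((1 : ℝ) : ℂ) ^ 2 / 2 * deriv u x)
      ((1 / 2) * deriv u x)
    rw [← e, norm_mul, norm_div, norm_one, RCLike.norm_ofNat] at this
    linarith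
  linarith

/-- Backward comparison of two solutions with close potentials. -/
lemma norm_sub_const_mul_le (h : IsCaratheodorySolution q u) (h₁ : IsCaratheodorySolution q₁ u₁)
    (hq : ∀ x, ‖q x‖ ≤ C) {δ B : ℝ} (hδ : ∀ x, ‖q₁ x - q x‖ ≤ δ) (hB : ∀ x, ‖u₁ x‖ ≤ B)
    {x₀ T : ℝ} (hT : 0 ≤ T) (c : ℂ) (h0 : u₁ x₀ = c * u x₀) :
    ‖u₁ (x₀ - T) - c * u (x₀ - T)‖ ≤
      (‖deriv u₁ x₀ - c * deriv u x₀‖ + δ * B * T) * Real.exp ((C + 1) * T) := by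
  have hC : 0 ≤ C := (norm_nonneg _).trans (hq 0)
  have hδ0 : 0 ≤ δ := (norm_nonneg _).trans (hδ 0)
  have hB0 : 0 ≤ B := (norm_nonneg _).trans (hB 0)
  set w : ℝ → ℂ := fun x => u₁ x - c * u x with hw
  set z : ℝ → ℂ := fun x => deriv u₁ x - c * deriv u x with hz
  have cw : Continuous w := h₁.continuous.sub (continuous_const.mul h.continuous)
  have cz : Continuous z := h₁.continuous_deriv.sub (continuous_const.mul h.continuous_deriv)
  have hwz : ∀ x, HasDerivAt w (z x) x := fun x =>
    (h₁.differentiable x).hasDerivAt.sub ((h.differentiable x).hasDerivAt.const_mul c)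
  -- Integrated form of z' = q w + (q₁ - q) u₁.
  have hzint : ∀ x, z x₀ - z x = ∫ y in x..x₀, (q y * w y + (q₁ y - q y) * u₁ y) := by
    intro x
    have e : z x₀ - z x = (deriv u₁ x₀ - deriv u₁ x) - c * (deriv u x₀ - deriv u x) := by
      simp only [hz]; ring
    rw [e, ← h₁.integral_eq_sub, ← h.integral_eq_sub, ← intervalIntegral.integral_const_mul,
      ← intervalIntegral.integral_sub (h₁.intervalIntegrable _ _)
        ((h.intervalIntegrable _ _).const_mul c)]
    congr 1; ext y; simp only [hw]; ring
  have bz : ∀ s ∈ Set.Icc 0 T,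
      ‖z (x₀ - s)‖ ≤ ‖z x₀‖ + δ * B * T + C * ∫ y in (x₀ - s)..x₀, ‖w y‖ := by
    intro s hs
    have b : ‖z x₀ - z (x₀ - s)‖ ≤ ∫ y in (x₀ - s)..x₀, (C * ‖w y‖ + δ * B) := by
      rw [hzint]
      refine intervalIntegral.norm_integral_le_of_norm_le (by linarith [hs.1])
        (Eventually.of_forall fun y _ => ?_) (Continuous.intervalIntegrable (by fun_prop) _ _)
      refine (norm_add_le _ _).trans (add_le_add ?_ ?_)
      · rw [norm_mul]; exact mul_le_mul_of_nonneg_right (hq y) (norm_nonneg _)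
      · rw [norm_mul]; exact mul_le_mul (hδ y) (hB y) (norm_nonneg _) hδ0
    rw [intervalIntegral.integral_add (Continuous.intervalIntegrable (by fun_prop) _ _)
      (Continuous.intervalIntegrable (by fun_prop) _ _), intervalIntegral.integral_const_mul,
      intervalIntegral.integral_const, sub_sub_cancel, smul_eq_mul] at b
    have b' : s * (δ * B) ≤ δ * B * T := by
      rw [mul_comm]; exact mul_le_mul_of_nonneg_left hs.2 (by positivity)
    have := norm_sub_norm_le (z (x₀ - s)) (z x₀)
    rw [norm_sub_rev (z (x₀ - s))] at this
    linarith
  have bw : ∀ s ∈ Set.Icc 0 T, ‖w (x₀ - s)‖ ≤ ∫ y in (x₀ - s)..x₀, ‖z y‖ := by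
    intro s hs
    have e := intervalIntegral.integral_eq_sub_of_hasDerivAt (a := x₀ - s) (b := x₀)
      (fun y _ => hwz y) (cz.intervalIntegrable _ _)
    have w0 : w x₀ = 0 := by simp [hw, h0]
    rw [w0, zero_sub] at e
    rw [← norm_neg, ← e]
    exact intervalIntegral.norm_integral_le_integral_norm (by linarith [hs.1])
  -- Grönwall in reversed time for |w| + |z|: the rate C + 1 collects C from z' and 1 from w' = z.
  have fin := le_mul_exp_of_le_add_integral (f := fun s => ‖w (x₀ - s)‖ + ‖z (x₀ - s)‖)
    (a := ‖z x₀‖ + δ * B * T) (C := C + 1) (T := T) (by fun_prop) (by linarith) hT (fun s hs => by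
      have e : ∫ t in (0 : ℝ)..s, (‖w (x₀ - t)‖ + ‖z (x₀ - t)‖) =
          ∫ y in (x₀ - s)..x₀, (‖w y‖ + ‖z y‖) := by
        have := intervalIntegral.integral_comp_sub_left (a := 0) (b := s)
          (fun y => ‖w y‖ + ‖z y‖) x₀
        simpa using this
      rw [e, intervalIntegral.integral_add (cw.norm.intervalIntegrable _ _)
        (cz.norm.intervalIntegrable _ _)]
      have p1 : 0 ≤ ∫ y in (x₀ - s)..x₀, ‖w y‖ :=
        intervalIntegral.integral_nonneg (by linarith [hs.1]) fun _ _ => norm_nonneg _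
      have p2 : 0 ≤ ∫ y in (x₀ - s)..x₀, ‖z y‖ :=
        intervalIntegral.integral_nonneg (by linarith [hs.1]) fun _ _ => norm_nonneg _
      have := bz s hs
      have := bw s hs
      have := mul_nonneg hC p2
      linarith)
  exact (le_add_of_nonneg_right (norm_nonneg _)).trans fin

end IsCaratheodorySolution

/-! ### Hölder continuity on the circle -/

/-- A function that is piecewise Hölder on a subdivision of `[0, 1]` is Hölder on `[0, 1]`. -/
lemma holder_of_piecewise_holder {f : ℝ → ℝ} {γ K : ℝ} (hγ : 0 < γ) (hK : 0 ≤ K) {n : ℕ}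
    {a : Fin (n + 1) → ℝ} (h : ∀ i : Fin n, ∀ y₁ ∈ Set.Icc (a i.castSucc) (a i.succ),
      ∀ y₂ ∈ Set.Icc (a i.castSucc) (a i.succ), |f y₁ - f y₂| ≤ K * |y₁ - y₂| ^ γ)
    (i : Fin (n + 1)) {s t : ℝ} (hs : a 0 ≤ s) (hst : s ≤ t) (ht : t ≤ a i) :
    |f s - f t| ≤ i * K * (t - s) ^ γ := by
  induction i using Fin.induction generalizing s t with
  | zero =>
    have : s = t := le_antisymm hst (ht.trans hs)
    simp [this]
  | succ i ih =>
    have hp : 0 ≤ (t - s) ^ γ := Real.rpow_nonneg (by linarith) _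
    have hsucc : ((i.succ : Fin (n + 1)) : ℝ) = (i.castSucc : Fin (n + 1)) + 1 := by simp
    have hi : (0 : ℝ) ≤ (i.castSucc : Fin (n + 1)) := by positivity
    rw [hsucc]
    have direct : ∀ x y, a i.castSucc ≤ x → x ≤ y → y ≤ a i.succ →
        |f x - f y| ≤ K * (y - x) ^ γ := fun x y h1 h2 h3 => by
      have := h i x ⟨h1, h2.trans h3⟩ y ⟨h1.trans h2, h3⟩
      rwa [abs_sub_comm x y, abs_of_nonneg (by linarith : 0 ≤ y - x)] at this
    rcases le_total t (a i.castSucc) with h1 | h1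
    · have := ih hs hst h1
      nlinarith [mul_nonneg hK hp]
    rcases le_total (a i.castSucc) s with h2 | h2
    · have := direct s t h2 hst ht
      nlinarith [mul_nonneg (mul_nonneg hi hK) hp]
    · have e1 := ih hs h2 le_rfl
      have e2 := direct _ t le_rfl h1 ht
      have m1 : (a i.castSucc - s) ^ γ ≤ (t - s) ^ γ :=
        Real.rpow_le_rpow (by linarith) (by linarith) hγ.le
      have m2 : (t - a i.castSucc) ^ γ ≤ (t - s) ^ γ :=
        Real.rpow_le_rpow (by linarith) (by linarith) hγ.le
      have n1 := mul_le_mul_of_nonneg_left m1 (mul_nonneg hi hK)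
      have n2 := mul_le_mul_of_nonneg_left m2 hK
      have := abs_sub_le (f s) (f (a i.castSucc)) (f t)
      linarith

/-- A `1`-periodic function that is Hölder on `[0, 1]` is uniformly Hölder at unit scale. -/
lemma holder_of_periodic {f : ℝ → ℝ} (hf : Function.Periodic f 1) {γ K : ℝ} (hγ : 0 < γ)
    (hK : 0 ≤ K) (h : ∀ s t, 0 ≤ s → s ≤ t → t ≤ 1 → |f s - f t| ≤ K * (t - s) ^ γ)
    {s t : ℝ} (hst : s ≤ t) (ht : t ≤ s + 1) : |f s - f t| ≤ 2 * K * (t - s) ^ γ := by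
  have shift : ∀ (m : ℤ) (x y : ℝ), (m : ℝ) ≤ x → x ≤ y → y ≤ m + 1 →
      |f x - f y| ≤ K * (y - x) ^ γ := by
    intro m x y h1 h2 h3
    have := h (x - m) (y - m) (by linarith) (by linarith) (by linarith)
    have hx := hf.sub_zsmul_eq (x := x) m
    have hy := hf.sub_zsmul_eq (x := y) m
    simp only [zsmul_eq_mul, mul_one] at hx hy
    rwa [hx, hy, sub_sub_sub_cancel_right] at this
  have hp : 0 ≤ (t - s) ^ γ := Real.rpow_nonneg (by linarith) _
  have hKp := mul_nonneg hK hp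
  have f1 := Int.floor_le s
  have f2 := Int.lt_floor_add_one s
  -- An interval of length at most 1 is cut by at most one interior integer, hence the factor 2.
  rcases le_total t (⌊s⌋ + 1) with h1 | h1
  · have := shift ⌊s⌋ s t f1 hst h1
    linarith
  · have e1 := shift ⌊s⌋ s (⌊s⌋ + 1) f1 f2.le le_rfl
    have e2 := shift (⌊s⌋ + 1) (⌊s⌋ + 1) t (by push_cast; rfl) h1 (by push_cast; linarith)
    have m1 : (⌊s⌋ + 1 - s) ^ γ ≤ (t - s) ^ γ :=
      Real.rpow_le_rpow (by linarith) (by linarith) hγ.le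
    have m2 : (t - (⌊s⌋ + 1)) ^ γ ≤ (t - s) ^ γ :=
      Real.rpow_le_rpow (by linarith) (by linarith) hγ.le
    have n1 := mul_le_mul_of_nonneg_left m1 hK
    have n2 := mul_le_mul_of_nonneg_left m2 hK
    have := abs_sub_le (f s) (f (⌊s⌋ + 1)) (f t)
    linarith

/-- The pieces are closed, so neighbouring ones share their endpoint value and no jump is possible;
periodicity likewise glues 1 to 0. Piecewise Hölder is thus Hölder on the whole circle, with a worse
constant. -/
theorem IsPiecewiseHolderSnd.exists_holder {γ : ℝ} {V : UnitAddCircle × UnitAddCircle → ℝ}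
    (hV : IsPiecewiseHolderSnd γ V) (hγ : 0 < γ) :
    ∃ K : ℝ, 0 ≤ K ∧ ∀ x y h : UnitAddCircle, |V (x, y + h) - V (x, y)| ≤ K * ‖h‖ ^ γ := by
  obtain ⟨n, a, -, ha0, ha1, K, hK⟩ := hV.holder
  refine ⟨2 * (n * |K|), by positivity, fun x y h => ?_⟩
  have unit : ∀ s t : ℝ, 0 ≤ s → s ≤ t → t ≤ 1 →
      |V (x, (s : UnitAddCircle)) - V (x, (t : UnitAddCircle))| ≤ n * |K| * (t - s) ^ γ := by
    intro s t h0 h1 h2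
    have := holder_of_piecewise_holder (f := fun y : ℝ => V (x, (y : UnitAddCircle))) hγ
      (abs_nonneg K) (a := a) (fun i y₁ h₁ y₂ h₂ => (hK x i y₁ h₁ y₂ h₂).trans
        (mul_le_mul_of_nonneg_right (le_abs_self K) (Real.rpow_nonneg (abs_nonneg _) _)))
      (Fin.last n) (s := s) (t := t) (by rwa [ha0]) h1 (by rwa [ha1])
    simpa using this
  have per : Function.Periodic (fun y : ℝ => V (x, (y : UnitAddCircle))) 1 := fun y => by
    simp only [AddCircle.coe_add, AddCircle.coe_period, add_zero]
  have step := fun s t => holder_of_periodic per hγ (by positivity) unit (s := s) (t := t)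
  obtain ⟨y, rfl⟩ := QuotientAddGroup.mk_surjective y
  obtain ⟨r, rfl⟩ := QuotientAddGroup.mk_surjective h
  set d : ℝ := r - round r with hd
  have hrd : (QuotientAddGroup.mk r : UnitAddCircle) = (d : UnitAddCircle) := by
    have : ((round r : ℝ) : UnitAddCircle) = 0 := by
      rw [AddCircle.coe_eq_zero_iff]
      exact ⟨round r, by simp⟩
    rw [hd, AddCircle.coe_sub, this, sub_zero]
  -- The representative nearest 0 realises the circle norm and keeps the displacement within unit
  -- scale.
  have hnorm : ‖(QuotientAddGroup.mk r : UnitAddCircle)‖ = |d| := UnitAddCircle.norm_eq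
  have hd2 : |d| ≤ 1 / 2 := abs_sub_round r
  rw [hnorm, hrd]
  change |V (x, (y : UnitAddCircle) + (d : UnitAddCircle)) - V (x, (y : UnitAddCircle))| ≤ _
  rw [← AddCircle.coe_add]
  rcases le_total 0 d with h0 | h0
  · rw [abs_of_nonneg h0] at hd2 ⊢
    have := step y (y + d) (by linarith) (by linarith)
    rw [abs_sub_comm, add_sub_cancel_left] at this
    exact this
  · rw [abs_of_nonpos h0] at hd2 ⊢
    have := step (y + d) y (by linarith) (by linarith)
    rwa [show y - (y + d) = -d by ring] at this

/-! ### Arithmetic of the frequency -/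

/-- Super-exponential approximations of `ω` by rationals with arbitrarily large denominator. -/
theorem frequently_norm_le_exp_of_betaExponent_eq_top {ω : ℝ} (hω : betaExponent ω = ⊤) (L : ℝ) :
    ∃ᶠ k : ℕ in atTop, ‖((k * ω : ℝ) : UnitAddCircle)‖ ≤ Real.exp (-(L * k)) := by
  have h : (L : EReal) < betaExponent ω := hω ▸ EReal.coe_lt_top L
  have := frequently_lt_of_lt_limsup (h := h)
  refine (this.and_eventually (eventually_gt_atTop 0)).mono fun k hk => ?_
  obtain ⟨h1, hk0⟩ := hk
  have hkpos : (0 : EReal) < (k : EReal) := by exact_mod_cast hk0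
  rw [EReal.lt_div_iff hkpos (EReal.natCast_ne_top k)] at h1
  -- The case kω ∈ ℤ, which occurs for rational ω, is separate because the real logarithm does not
  -- see -ln 0 = +∞.
  rcases (norm_nonneg ((k * ω : ℝ) : UnitAddCircle)).eq_or_lt with h0 | h0
  · rw [← h0]; exact (Real.exp_pos _).le
  rw [ENNReal.log_pos_real' (by rwa [ENNReal.toReal_ofReal h0.le]), ENNReal.toReal_ofReal h0.le]
    at h1
  have h2 : L * k < -Real.log ‖((k * ω : ℝ) : UnitAddCircle)‖ := by exact_mod_cast h1
  rw [← Real.log_le_iff_le_exp h0]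
  linarith

/-! ### Square integrable solutions: decay, Wronskian, contradiction -/

/-- Integrals of an integrable function over unit intervals vanish at infinity. -/
lemma MeasureTheory.Integrable.tendsto_integral_unit_interval {f : ℝ → ℝ} (hf : Integrable f) :
    Tendsto (fun x => ∫ y in x..(x + 1), f y) (cocompact ℝ) (nhds 0) := by
  have : (cocompact ℝ).IsCountablyGenerated := by
    rw [cocompact_eq_atBot_atTop]; infer_instance
  have h := tendsto_integral_filter_of_dominated_convergence (μ := volume) (l := cocompact ℝ)
    (F := fun x y => (Set.Ioc x (x + 1)).indicator f y) (f := fun _ => 0) (fun y => ‖f y‖)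
    (Eventually.of_forall fun x => hf.aestronglyMeasurable.indicator measurableSet_Ioc)
    (Eventually.of_forall fun x => Eventually.of_forall fun y => norm_indicator_le_norm_self f y)
    hf.norm (Eventually.of_forall fun y => ?_)
  · simp only [integral_zero] at h
    refine h.congr fun x => ?_
    rw [integral_indicator measurableSet_Ioc, intervalIntegral.integral_of_le (by linarith)]
  · refine tendsto_const_nhds.congr' ?_
    filter_upwards [(isCompact_Icc (a := y - 1) (b := y)).compl_mem_cocompact] with x hx
    refine (Set.indicator_of_notMem (fun hy => hx ⟨?_, ?_⟩) f).symm
    · linarith [hy.2]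
    · exact hy.1.le

namespace IsCaratheodorySolution

variable {q u : ℝ → ℂ} {C : ℝ}

/-- Pointwise t ≤ ε + t²/ε. The free ε turns small local L² mass into small local L¹ mass. -/
lemma integral_norm_le (h : IsCaratheodorySolution q u) {ε : ℝ} (hε : 0 < ε) (x : ℝ) :
    ∫ y in x..(x + 1), ‖u y‖ ≤ ε + ε⁻¹ * ∫ y in x..(x + 1), ‖u y‖ ^ 2 := by
  have c := h.continuous
  have e : ε + ε⁻¹ * ∫ y in x..(x + 1), ‖u y‖ ^ 2 =
      ∫ y in x..(x + 1), (ε + ε⁻¹ * ‖u y‖ ^ 2) := by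
    rw [intervalIntegral.integral_add (Continuous.intervalIntegrable (by fun_prop) _ _)
      (Continuous.intervalIntegrable (by fun_prop) _ _), intervalIntegral.integral_const_mul]
    simp
  rw [e]
  refine intervalIntegral.integral_mono_on (by linarith)
    (Continuous.intervalIntegrable (by fun_prop) _ _)
    (Continuous.intervalIntegrable (by fun_prop) _ _) fun y _ => ?_
  have h1 : ε + ε⁻¹ * ‖u y‖ ^ 2 - ‖u y‖ = ε⁻¹ * ((ε - ‖u y‖) ^ 2 + ε * ‖u y‖) := by
    field_simp; ring
  have : 0 ≤ ε⁻¹ * ((ε - ‖u y‖) ^ 2 + ε * ‖u y‖) := by positivity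
  linarith

/-- The tails of ∫|u|² over unit intervals vanish, and these control u and u' pointwise through the
local L¹ bound. -/
lemma tendsto_zero (h : IsCaratheodorySolution q u) (hq : ∀ x, ‖q x‖ ≤ C) (hu : MemLp u 2) :
    Tendsto (fun x => ‖u x‖ + ‖deriv u x‖) (cocompact ℝ) (nhds 0) := by
  have hC : 0 ≤ C := (norm_nonneg _).trans (hq 0)
  have hsq : Integrable (fun x => ‖u x‖ ^ 2) :=
    (memLp_two_iff_integrable_sq_norm hu.aestronglyMeasurable).1 hu
  have hI := hsq.tendsto_integral_unit_interval
  rw [Metric.tendsto_nhds]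
  intro η hη
  set ε := η / (2 * (19 * (1 + C))) with hε
  have hε0 : 0 < ε := by positivity
  have h2 : Tendsto (fun x => ε⁻¹ * ∫ y in x..(x + 1), ‖u y‖ ^ 2) (cocompact ℝ) (nhds 0) := by
    simpa using hI.const_mul ε⁻¹
  filter_upwards [h2.eventually_lt_const hε0] with x hx
  rw [Real.dist_eq, sub_zero, abs_of_nonneg (by positivity)]
  refine (h.norm_add_norm_deriv_le hq x).trans_lt ?_
  have h3 : ∫ y in x..(x + 1), ‖u y‖ < 2 * ε := by linarith [h.integral_norm_le hε0 x]
  calc 19 * (1 + C) * ∫ y in x..(x + 1), ‖u y‖ < 19 * (1 + C) * (2 * ε) :=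
        mul_lt_mul_of_pos_left h3 (by positivity)
    _ = η := by rw [hε]; field_simp

lemma exists_bound (h : IsCaratheodorySolution q u) (hq : ∀ x, ‖q x‖ ≤ C) (hu : MemLp u 2) :
    ∃ B, ∀ x, ‖u x‖ ≤ B ∧ ‖deriv u x‖ ≤ B := by
  have hC : 0 ≤ C := (norm_nonneg _).trans (hq 0)
  have hsq : Integrable (fun x => ‖u x‖ ^ 2) :=
    (memLp_two_iff_integrable_sq_norm hu.aestronglyMeasurable).1 hu
  refine ⟨19 * (1 + C) * (1 + ∫ x, ‖u x‖ ^ 2), fun x => ?_⟩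
  have h1 := h.norm_add_norm_deriv_le hq x
  have h2 := h.integral_norm_le one_pos x
  have h3 : ∫ y in x..(x + 1), ‖u y‖ ^ 2 ≤ ∫ y, ‖u y‖ ^ 2 := by
    rw [intervalIntegral.integral_of_le (by linarith)]
    exact setIntegral_le_integral hsq (Eventually.of_forall fun y => by positivity)
  have h4 : 19 * (1 + C) * ∫ y in x..(x + 1), ‖u y‖ ≤ 19 * (1 + C) * (1 + ∫ x, ‖u x‖ ^ 2) :=
    mul_le_mul_of_nonneg_left (by linarith) (by positivity)
  constructor <;> linarith [norm_nonneg (u x), norm_nonneg (deriv u x)]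

/-- The Wronskian of a square integrable solution and its translate is controlled by the
oscillation of the potential under the translation. -/
lemma norm_wronskian_le (h : IsCaratheodorySolution q u) (hq : ∀ x, ‖q x‖ ≤ C) (hu : MemLp u 2)
    {δ T : ℝ} (hδ : ∀ x, ‖q (x + T) - q x‖ ≤ δ) (x : ℝ) :
    ‖u x * deriv u (x + T) - deriv u x * u (x + T)‖ ≤ δ * ∫ y, ‖u y‖ ^ 2 := by
  have hδ0 : 0 ≤ δ := (norm_nonneg _).trans (hδ 0)
  have hsq : Integrable (fun x => ‖u x‖ ^ 2) :=
    (memLp_two_iff_integrable_sq_norm hu.aestronglyMeasurable).1 hu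
  have hsqT : Integrable (fun x => ‖u (x + T)‖ ^ 2) := hsq.comp_add_right T
  obtain ⟨B, hB⟩ := h.exists_bound hq hu
  have hl := (h.tendsto_zero hq hu).mono_left (atTop_le_cocompact (α := ℝ))
  -- The translate is merely bounded here; decay of u and u' suffices to kill the boundary term at
  -- +∞.
  have hW : Tendsto (fun b => u b * deriv u (b + T) - deriv u b * u (b + T)) atTop (nhds 0) := by
    refine squeeze_zero_norm (fun b => ?_) (by simpa using hl.mul_const B)
    refine (norm_sub_le _ _).trans ?_
    rw [norm_mul, norm_mul, add_mul]
    exact add_le_add (mul_le_mul_of_nonneg_left (hB _).2 (norm_nonneg _))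
      (mul_le_mul_of_nonneg_left (hB _).1 (norm_nonneg _))
  have hlim := (hW.sub_const (u x * deriv u (x + T) - deriv u x * u (x + T))).norm
  rw [zero_sub, norm_neg] at hlim
  refine le_of_tendsto hlim ?_
  filter_upwards [eventually_ge_atTop x] with b hb
  have key := h.norm_wronskian_sub_le (h.comp_add_right T) hδ hb
  simp only [deriv_comp_add_const] at key
  refine key.trans (mul_le_mul_of_nonneg_left ?_ hδ0)
  have c := h.continuous
  calc ∫ y in x..b, ‖u y‖ * ‖u (y + T)‖
      ≤ ∫ y in x..b, (‖u y‖ ^ 2 + ‖u (y + T)‖ ^ 2) / 2 :=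
        intervalIntegral.integral_mono_on hb (Continuous.intervalIntegrable (by fun_prop) _ _)
          (Continuous.intervalIntegrable (by fun_prop) _ _)
          fun y _ => by linarith [two_mul_le_add_sq ‖u y‖ ‖u (y + T)‖]
    _ ≤ ∫ y, (‖u y‖ ^ 2 + ‖u (y + T)‖ ^ 2) / 2 := by
        rw [intervalIntegral.integral_of_le hb]
        exact setIntegral_le_integral ((hsq.add hsqT).div_const 2)
          (Eventually.of_forall fun y => by positivity)
    _ = ∫ y, ‖u y‖ ^ 2 := by
        rw [integral_div, integral_add hsq hsqT,
          integral_add_right_eq_self (fun y => ‖u y‖ ^ 2) T]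
        ring

/-- A bounded potential with super-exponentially good almost periods has no nonzero square
integrable solutions. -/
theorem eq_zero_of_almost_periods (h : IsCaratheodorySolution q u) (hq : ∀ x, ‖q x‖ ≤ C)
    (hu : MemLp u 2) {K : ℝ} (hper : ∀ L : ℝ, ∃ᶠ k : ℕ in atTop,
      ∀ x, ‖q (x + k) - q x‖ ≤ K * Real.exp (-(L * k))) (x₀ : ℝ) : u x₀ = 0 := by
  by_contra hne
  have hp : 0 < ‖u x₀‖ := norm_pos_iff.2 hne
  obtain ⟨B, hB⟩ := h.exists_bound hq hu
  set N := ∫ y, ‖u y‖ ^ 2 with hN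
  have hu0 : Tendsto (fun x => ‖u x‖) (cocompact ℝ) (nhds 0) :=
    squeeze_zero (fun x => norm_nonneg _) (fun x => le_add_of_nonneg_right (norm_nonneg _))
      (h.tendsto_zero hq hu)
  have hright : Tendsto (fun k : ℕ => ‖u (x₀ + k)‖) atTop (nhds 0) :=
    (hu0.mono_left atTop_le_cocompact).comp
      (tendsto_atTop_add_const_left _ _ tendsto_natCast_atTop_atTop)
  have hleft : Tendsto (fun k : ℕ => ‖u (x₀ - k)‖) atTop (nhds 0) :=
    (hu0.mono_left atBot_le_cocompact).comp
      (tendsto_atBot_add_const_left _ _ (tendsto_neg_atTop_atBot.comp tendsto_natCast_atTop_atTop))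
  have herr : Tendsto (fun k : ℕ => K * (N / ‖u x₀‖ + B * k) * Real.exp (-(k : ℝ))) atTop
      (nhds 0) := by
    have e0 : Tendsto (fun t : ℝ => Real.exp (-t)) atTop (nhds 0) :=
      Real.tendsto_exp_neg_atTop_nhds_zero
    have e1 : Tendsto (fun t : ℝ => t * Real.exp (-t)) atTop (nhds 0) := by
      simpa using Real.tendsto_pow_mul_exp_neg_atTop_nhds_zero 1
    have := ((e0.const_mul (K * (N / ‖u x₀‖))).add (e1.const_mul (K * B))).comp
      (tendsto_natCast_atTop_atTop (R := ℝ))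
    simp only [mul_zero, add_zero] at this
    refine this.congr fun k => ?_
    simp only [Function.comp]
    ring
  have half : 0 < ‖u x₀‖ / 2 := by positivity
  -- L = C + 2 leaves e^{-k} after the Grönwall factor e^{(C+1)k}, enough to absorb the linear term
  -- B·k.
  obtain ⟨k, hk, ⟨hr, hl⟩, he⟩ := ((hper (C + 2)).and_eventually
    (((hright.eventually_lt_const half).and (hleft.eventually_lt_const half)).and
      (herr.eventually_lt_const half))).exists
  set δ := K * Real.exp (-((C + 2) * k)) with hδ
  -- With this c the values agree exactly at x₀, and the mismatch of derivatives is the Wronskian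
  -- divided by u(x₀).
  set c := u (x₀ + k) / u x₀ with hc
  have hcu : u (x₀ + k) = c * u x₀ := by rw [hc, div_mul_cancel₀ _ hne]
  have hc1 : ‖c‖ ≤ 1 / 2 := by
    rw [hc, norm_div, div_le_iff₀ hp]; linarith
  have hder : ‖deriv u (x₀ + k) - c * deriv u x₀‖ ≤ δ * (N / ‖u x₀‖) := by
    have e : deriv u (x₀ + k) - c * deriv u x₀ =
        (u x₀ * deriv u (x₀ + k) - deriv u x₀ * u (x₀ + k)) / u x₀ := by
      rw [hc]; field_simp
    rw [e, norm_div, ← mul_div_assoc]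
    exact div_le_div_of_nonneg_right (h.norm_wronskian_le hq hu hk x₀) hp.le
  have key := h.norm_sub_const_mul_le (h.comp_add_right k) hq hk (fun x => (hB (x + k)).1)
    (x₀ := x₀) (T := k) (by positivity) c hcu
  simp only [deriv_comp_add_const, sub_add_cancel] at key
  have hfin : ‖u x₀ - c * u (x₀ - k)‖ < ‖u x₀‖ / 2 := by
    refine (key.trans ?_).trans_lt he
    calc _ ≤ (δ * (N / ‖u x₀‖) + δ * B * k) * Real.exp ((C + 1) * k) := by gcongr
      _ = K * (N / ‖u x₀‖ + B * k) * (Real.exp (-((C + 2) * k)) * Real.exp ((C + 1) * k)) := by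
        rw [hδ]; ring
      _ = _ := by rw [← Real.exp_add]; congr 2; ring
  -- |u(x₀)| < |u(x₀)|/2 + |u(x₀)|/4 is absurd.
  have h1 := norm_sub_norm_le (u x₀) (c * u (x₀ - k))
  rw [norm_mul] at h1
  have h2 : ‖c‖ * ‖u (x₀ - k)‖ ≤ 1 / 2 * (‖u x₀‖ / 2) := by gcongr
  linarith

end IsCaratheodorySolution

/-! ### Application to the Schrödinger operator -/

/-- Solutions of the eigenvalue equation are Carathéodory solutions of `u'' = (V - E) u`. -/
lemma MemSchrodingerDomain.isCaratheodorySolution {V : UnitAddCircle × UnitAddCircle → ℝ} {ω : ℝ}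
    {E : ℂ} {u : ℝ → ℂ} (hu : MemSchrodingerDomain V ω u)
    (h : schrodinger V ω u =ᵐ[volume] fun x => E * u x) :
    IsCaratheodorySolution
      (fun x : ℝ => (V ((x : UnitAddCircle), ((ω * x : ℝ) : UnitAddCircle)) : ℂ) - E) u := by
  refine ⟨hu.differentiable, hu.deriv_absolutelyContinuous, ?_⟩
  have hd : ∀ᵐ x, DifferentiableAt ℝ (deriv u) x := by
    have : ∀ n : ℕ, ∀ᵐ x, x ∈ Set.uIcc (-(n : ℝ)) n → DifferentiableAt ℝ (deriv u) x := fun n =>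
      (hu.deriv_absolutelyContinuous _ _).ae_differentiableAt_complex
    filter_upwards [ae_all_iff.2 this] with x hx
    obtain ⟨n, hn⟩ := exists_nat_ge |x|
    refine hx n ?_
    rw [Set.uIcc_of_le (by linarith [abs_nonneg x])]
    exact abs_le.1 hn
  filter_upwards [hd, h] with x hx he
  refine hx.hasDerivAt.congr_deriv ?_
  simp only [schrodinger] at he
  linear_combination -he

theorem mainTheorem2 (V : UnitAddCircle × UnitAddCircle → ℝ) (γ : ℝ) (hγ : 0 < γ)
    (hV : IsPiecewiseHolderSnd γ V) (ω : ℝ) (hω : betaExponent ω = ⊤) :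
    ∀ E : ℂ, ¬ IsSchrodingerEigenvalue V ω E := by
  rintro E ⟨u, hu, hne, heq⟩
  obtain ⟨M, hM⟩ := hV.bounded
  obtain ⟨K, hK0, hK⟩ := hV.exists_holder hγ
  refine hne (Eventually.of_forall fun x₀ => ?_)
  refine (hu.isCaratheodorySolution heq).eq_zero_of_almost_periods (C := M + ‖E‖) (K := K)
    (fun x => ?_) hu.memLp (fun L => ?_) x₀
  · refine (norm_sub_le _ _).trans (add_le_add ?_ le_rfl)
    simpa using hM _
  -- The rate L/γ compensates the Hölder exponent: (e^{-(L/γ)k})^γ = e^{-Lk}.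
  · refine (frequently_norm_le_exp_of_betaExponent_eq_top hω (L / γ)).mono fun k hk x => ?_
    have h1 : ((x + k : ℝ) : UnitAddCircle) = x := by
      have : ((k : ℝ) : UnitAddCircle) = 0 := by
        rw [AddCircle.coe_eq_zero_iff]
        exact ⟨k, by simp⟩
      rw [AddCircle.coe_add, this, add_zero]
    have h2 : ((ω * (x + k) : ℝ) : UnitAddCircle) =
        ((ω * x : ℝ) : UnitAddCircle) + ((k * ω : ℝ) : UnitAddCircle) := by
      rw [← AddCircle.coe_add]; congr 1; ring
    rw [h1, h2, sub_sub_sub_cancel_right, ← Complex.ofReal_sub, Complex.norm_real,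
      Real.norm_eq_abs]
    refine (hK _ _ _).trans (mul_le_mul_of_nonneg_left ?_ hK0)
    refine (Real.rpow_le_rpow (norm_nonneg _) hk hγ.le).trans (le_of_eq ?_)
    rw [← Real.exp_mul]
    congr 1
    field_simp
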